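/- Let $R$ be an associative ring with identity (not necessarily commutative). An element $p\in R$ is potent if $p=p^m$ for some integer $m\ge 2$. By an ideal of $R$ we mean a two-sided ideal. An ideal $P\neq R$ is prime if, for all ideals $I,J$ of $R$, $IJ\subseteq P$ implies $I\subseteq P$ or $J\subseteq P$; an ideal $P\ne R$ is completely prime if, for all $a,b\in R$, $ab\in P$ implies $a\in P$ or $b\in P$. The prime radical $P(R)$ is the intersection of all prime ideals of $R$. The ring $R$ is strongly periodic if for every $a\in R$ there exists a potent $p\in R$ such that $a-p\in P(R)$ and $ap=pa$; it is weakly periodic if for every $a\in R$ there exists a potent $p\in R$ such that $a-p$ is nilpotent. Then $R$ is strongly periodic if and only if the following two conditions hold: (1) $R$ is weakly periodic; (2) every prime ideal of $R$ is completely prime. -/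

import Mathlib

/-- An element `p` is potent if `p = p ^ m` for some `m ≥ 2`. -/
def IsPotentElement {R : Type*} [Ring R] (p : R) : Prop :=
  ∃ m : ℕ, 2 ≤ m ∧ p = p ^ m

namespace TwoSidedIdeal

/-- A two-sided ideal `P` of a (not necessarily commutative) ring is prime if it is proper and,
for all two-sided ideals `I`, `J`, the inclusion `I J ⊆ P` implies `I ⊆ P` or `J ⊆ P`.
Since `P` is closed under addition, `I J ⊆ P` says that `P` contains all products `a * b` with
`a ∈ I` and `b ∈ J`. -/
def IsPrimeIdeal {R : Type*} [Ring R] (P : TwoSidedIdeal R) : Prop :=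
  P ≠ ⊤ ∧ ∀ I J : TwoSidedIdeal R, (∀ a ∈ I, ∀ b ∈ J, a * b ∈ P) → I ≤ P ∨ J ≤ P

/-- A two-sided ideal `P` is completely prime if it is proper and `a * b ∈ P` implies
`a ∈ P` or `b ∈ P` for all elements `a`, `b`. -/
def IsCompletelyPrimeIdeal {R : Type*} [Ring R] (P : TwoSidedIdeal R) : Prop :=
  P ≠ ⊤ ∧ ∀ a b : R, a * b ∈ P → a ∈ P ∨ b ∈ P

end TwoSidedIdeal

/-- The prime radical: the intersection of all prime ideals (the whole ring if there are none,
that is, for the zero ring). -/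
def ringPrimeRadical (R : Type*) [Ring R] : TwoSidedIdeal R :=
  sInf {P : TwoSidedIdeal R | P.IsPrimeIdeal}

/-- A ring is strongly periodic if every element `a` admits a potent `p` commuting with `a`
such that `a - p` is in the prime radical. -/
def IsStronglyPeriodicRing (R : Type*) [Ring R] : Prop :=
  ∀ a : R, ∃ p : R, IsPotentElement p ∧ a - p ∈ ringPrimeRadical R ∧ a * p = p * a

/-- A ring is weakly periodic if every element `a` admits a potent `p` such that `a - p` is
nilpotent. -/
def IsWeaklyPeriodicRing (R : Type*) [Ring R] : Prop :=
  ∀ a : R, ∃ p : R, IsPotentElement p ∧ IsNilpotent (a - p)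

/-! The prime radical is always nil. If `R` is strongly periodic, every element of `R/P` is potent
for each prime `P`, so `R/P` is reduced, and a reduced prime ring has no zero divisors. Conversely,
completely prime ideals contain all nilpotents, so the prime radical is exactly the set of
nilpotents, and each `a - a ^ m` is nilpotent for some `m ≥ 2`. Taking `a = 2` gives positive
characteristic; then `a` generates a finite subring, its powers repeat, and some `a ^ n` is the
required potent. It commutes with `a` for free. -/

namespace TwoSidedIdeal

variable {R : Type*} [Ring R]

/-- The union of a nonempty chain of two-sided ideals. -/
theorem exists_forall_mem_iff_of_isChain {c : Set (TwoSidedIdeal R)} (hc : IsChain (· ≤ ·) c)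
    (hne : c.Nonempty) : ∃ U : TwoSidedIdeal R, ∀ x, x ∈ U ↔ ∃ I ∈ c, x ∈ I := by
  refine ⟨TwoSidedIdeal.mk' {x | ∃ I ∈ c, x ∈ I} ?_ ?_ ?_ ?_ ?_, fun x => ?_⟩
  · obtain ⟨I, hI⟩ := hne
    exact ⟨I, hI, I.zero_mem⟩
  · rintro x y ⟨I, hI, hx⟩ ⟨J, hJ, hy⟩
    rcases hc.total hI hJ with h | h
    · exact ⟨J, hJ, J.add_mem (h hx) hy⟩
    · exact ⟨I, hI, I.add_mem hx (h hy)⟩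
  · rintro x ⟨I, hI, hx⟩
    exact ⟨I, hI, I.neg_mem hx⟩
  · rintro x y ⟨I, hI, hy⟩
    exact ⟨I, hI, I.mul_mem_left _ _ hy⟩
  · rintro x y ⟨I, hI, hx⟩
    exact ⟨I, hI, I.mul_mem_right _ _ hx⟩
  · rw [mem_mk']
    rfl

/-- An element that is not nilpotent lies outside some prime ideal. -/
theorem exists_isPrimeIdeal_notMem {a : R} (ha : ¬ IsNilpotent a) :
    ∃ P : TwoSidedIdeal R, P.IsPrimeIdeal ∧ a ∉ P := by
  -- An ideal maximal among those avoiding all powers of `a` is prime; the exponent `0` keeps it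
  -- proper.
  obtain ⟨P, -, hP⟩ := zorn_le_nonempty₀ {I : TwoSidedIdeal R | ∀ n, a ^ n ∉ I}
    (fun c hcs hc y hy => by
      obtain ⟨U, hU⟩ := exists_forall_mem_iff_of_isChain hc ⟨y, hy⟩
      refine ⟨U, fun n hn => ?_, fun I hI x hx => (hU x).2 ⟨I, hI, hx⟩⟩
      obtain ⟨I, hI, hx⟩ := (hU _).1 hn
      exact hcs hI n hx)
    ⊥ (fun n hn => ha ⟨n, by simpa [mem_bot] using hn⟩)
  have key : ∀ I : TwoSidedIdeal R, ¬ I ≤ P → ∃ n, a ^ n ∈ P ⊔ I := by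
    intro I hI
    by_contra! h
    exact hI (le_sup_right.trans (hP.2 h le_sup_left))
  refine ⟨P, ⟨fun h => hP.1 0 (h ▸ mem_top R), fun I J hIJ => ?_⟩, fun h => hP.1 1 (by simpa)⟩
  by_contra! h
  obtain ⟨m, hm⟩ := key I h.1
  obtain ⟨n, hn⟩ := key J h.2
  obtain ⟨p, hp, x, hx, hpx⟩ := mem_sup.1 hm
  obtain ⟨q, hq, y, hy, hqy⟩ := mem_sup.1 hn
  refine hP.1 (m + n) ?_
  rw [pow_add, ← hpx, ← hqy, add_mul, mul_add x]
  exact P.add_mem (P.mul_mem_right _ _ hp) (P.add_mem (P.mul_mem_left _ _ hq) (hIJ x hx y hy))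

theorem IsPrimeIdeal.mem_or_mem_of_forall_mul_mul_mem {P : TwoSidedIdeal R} (hP : P.IsPrimeIdeal)
    {a b : R} (h : ∀ r, a * r * b ∈ P) : a ∈ P ∨ b ∈ P := by
  obtain ⟨J, hJ⟩ : ∃ J : TwoSidedIdeal R, ∀ y, y ∈ J ↔ ∀ r, a * r * y ∈ P := by
    refine ⟨TwoSidedIdeal.mk' {y | ∀ r, a * r * y ∈ P} ?_ ?_ ?_ ?_ ?_, fun y => ?_⟩
    · intro r
      simp
    · intro x y hx hy r
      simpa [mul_add] using P.add_mem (hx r) (hy r)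
    · intro x hx r
      simpa using P.neg_mem (hx r)
    · intro x y hy r
      simpa [mul_assoc] using hy (r * x)
    · intro x y hx r
      simpa [mul_assoc] using P.mul_mem_right _ y (hx r)
    · rw [mem_mk']
      rfl
  -- `I` is the left annihilator of `J` modulo `P`, so `I J ⊆ P` by construction.
  obtain ⟨I, hI⟩ : ∃ I : TwoSidedIdeal R, ∀ x, x ∈ I ↔ ∀ y ∈ J, x * y ∈ P := by
    refine ⟨TwoSidedIdeal.mk' {x | ∀ y ∈ J, x * y ∈ P} ?_ ?_ ?_ ?_ ?_, fun y => ?_⟩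
    · intro y _
      simp
    · intro x y hx hy z hz
      simpa [add_mul] using P.add_mem (hx z hz) (hy z hz)
    · intro x hx z hz
      simpa using P.neg_mem (hx z hz)
    · intro x y hy z hz
      simpa [mul_assoc] using P.mul_mem_left x _ (hy z hz)
    · intro x y hx z hz
      simpa [mul_assoc] using hx (y * z) (J.mul_mem_left _ _ hz)
    · rw [mem_mk']
      rfl
  have haI : a ∈ I := (hI a).2 fun y hy => by simpa using (hJ y).1 hy 1
  have hbJ : b ∈ J := (hJ b).2 h
  exact (hP.2 I J fun x hx y hy => (hI x).1 hx y hy).imp (fun h => h haI) (fun h => h hbJ)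

theorem IsCompletelyPrimeIdeal.mem_of_isNilpotent {P : TwoSidedIdeal R}
    (hP : P.IsCompletelyPrimeIdeal) {a : R} (ha : IsNilpotent a) : a ∈ P := by
  obtain ⟨n, hn⟩ := ha
  have key : ∀ n : ℕ, a ^ n ∈ P → a ∈ P := by
    intro n
    induction n with
    | zero =>
      intro h
      simpa using P.mul_mem_right _ a h
    | succ n ih =>
      intro h
      rw [pow_succ] at h
      exact (hP.2 _ _ h).elim ih id
  exact key n (hn ▸ P.zero_mem)

end TwoSidedIdeal

section

variable {R : Type*} [Ring R]

theorem isNilpotent_of_mem_ringPrimeRadical {a : R} (ha : a ∈ ringPrimeRadical R) :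
    IsNilpotent a := by
  by_contra h
  obtain ⟨P, hP, haP⟩ := TwoSidedIdeal.exists_isPrimeIdeal_notMem h
  exact haP ((TwoSidedIdeal.mem_sInf R).1 ha P hP)

theorem isReduced_of_forall_isPotentElement (h : ∀ x : R, IsPotentElement x) : IsReduced R where
  eq_zero x := by
    rintro ⟨n, hn⟩
    obtain ⟨m, hm, hx⟩ := h x
    have key : ∀ k : ℕ, x = x ^ (m ^ k) := by
      intro k
      induction k with
      | zero => simp
      | succ k ih => rw [pow_succ, pow_mul, ← ih, ← hx]
    rw [key n]
    exact pow_eq_zero_of_le (Nat.lt_pow_self hm).le hn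

theorem TwoSidedIdeal.IsPrimeIdeal.isCompletelyPrimeIdeal_of_forall_potent {P : TwoSidedIdeal R}
    (hP : P.IsPrimeIdeal) (h : ∀ a : R, ∃ p, IsPotentElement p ∧ a - p ∈ P) :
    P.IsCompletelyPrimeIdeal := by
  let π := P.ringCon.mk'
  have hπ : ∀ x, π x = 0 ↔ x ∈ P := fun x => by
    rw [← TwoSidedIdeal.mem_ker, TwoSidedIdeal.ker_ringCon_mk']
  have hpot : ∀ x : P.ringCon.Quotient, IsPotentElement x := by
    intro x
    obtain ⟨a, rfl⟩ := P.ringCon.mk'_surjective x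
    obtain ⟨p, ⟨m, hm, hp⟩, hap⟩ := h a
    have hπap : π a = π p := by rw [← sub_eq_zero, ← map_sub, hπ]; exact hap
    refine ⟨m, hm, ?_⟩
    change π a = π a ^ m
    rw [hπap, ← map_pow, ← hp]
  have := isReduced_of_forall_isPotentElement hpot
  refine ⟨hP.1, fun a b hab => ?_⟩
  refine hP.mem_or_mem_of_forall_mul_mul_mem fun r => ?_
  rw [← hπ] at hab ⊢
  rw [map_mul] at hab
  -- In a reduced ring `xy = 0` forces `yx = 0`, and then `(xry)² = 0`.
  have hba : π b * π a = 0 := by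
    refine IsReduced.eq_zero _ ⟨2, ?_⟩
    calc (π b * π a) ^ 2 = π b * (π a * π b) * π a := by noncomm_ring
      _ = 0 := by rw [hab]; simp
  refine IsReduced.eq_zero _ ⟨2, ?_⟩
  calc π (a * r * b) ^ 2 = π a * π r * (π b * π a) * π r * π b := by
        simp only [map_mul]; noncomm_ring
    _ = 0 := by rw [hba]; simp

/-- If two powers of `a` agree then `a` is, up to a nilpotent, a potent power of itself. -/
theorem exists_isPotentElement_pow_of_pow_eq_pow {a : R} {i j : ℕ} (hij : i < j)
    (h : a ^ i = a ^ j) : ∃ n : ℕ, IsPotentElement (a ^ n) ∧ IsNilpotent (a - a ^ n) := by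
  obtain ⟨d, rfl⟩ := Nat.exists_eq_add_of_lt hij
  have step : ∀ k, i ≤ k → ∀ n, a ^ (k + n * (d + 1)) = a ^ k := by
    intro k hk n
    obtain ⟨l, rfl⟩ := Nat.exists_eq_add_of_le hk
    induction n with
    | zero => simp
    | succ n ih =>
      rw [← ih, show i + l + (n + 1) * (d + 1) = (i + d + 1) + (l + n * (d + 1)) by ring, pow_add,
        ← h, ← pow_add, add_assoc]
  -- A multiple of the period `d + 1` past the preperiod `i`, so `a ^ s` is idempotent.
  set s := (i + 1) * (d + 1) with hs
  have his : i ≤ s := by rw [hs]; nlinarith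
  have he : IsIdempotentElem (a ^ s) := by
    rw [IsIdempotentElem, ← pow_add]
    exact step s his (i + 1)
  refine ⟨s + 1, ⟨d + 2, by omega, ?_⟩, s, ?_⟩
  · rw [← pow_mul, show (s + 1) * (d + 2) = (s + 1) + (s + 1) * (d + 1) by ring,
      step _ (by omega)]
  · have hc : Commute a (1 - a ^ s) := (Commute.one_right a).sub_right (Commute.self_pow a s)
    have hs0 : s ≠ 0 := by positivity
    obtain ⟨t, ht⟩ := Nat.exists_eq_succ_of_ne_zero hs0
    rw [show a - a ^ (s + 1) = a * (1 - a ^ s) by rw [mul_sub, mul_one, pow_succ'], hc.mul_pow]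
    have := he.one_sub.pow_succ_eq t
    rw [← Nat.succ_eq_add_one, ← ht] at this
    rw [this, he.mul_one_sub_self]

/-- A power of the monic `X ^ m - X` kills `a`, so `a` generates a finite module over the finite
ring `ZMod n`, and pigeonhole applies to its powers. -/
theorem exists_pow_eq_pow_of_isNilpotent_sub_pow {N : ℕ} (hN : N ≠ 0) (hNR : (N : R) = 0)
    {a : R} {m : ℕ} (hm : 2 ≤ m) (ha : IsNilpotent (a - a ^ m)) :
    ∃ i j : ℕ, i < j ∧ a ^ i = a ^ j := by
  obtain ⟨k, hk⟩ := ha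
  have : NeZero N := ⟨hN⟩
  obtain ⟨n, hn⟩ := CharP.exists R
  have hnN : n ∣ N := (CharP.cast_eq_zero_iff R n N).1 hNR
  have : NeZero n := ⟨fun h => hN (by simpa [h] using hnN)⟩
  let := ZMod.algebra R n
  have hint : IsIntegral (ZMod n) a := by
    refine ⟨(Polynomial.X ^ m - Polynomial.X) ^ k, ?_, ?_⟩
    · refine Polynomial.Monic.pow (Polynomial.monic_X_pow_sub ?_) k
      exact Polynomial.degree_X_le.trans_lt (by exact_mod_cast Nat.lt_of_lt_of_le one_lt_two hm)
    · rw [← Polynomial.aeval_def]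
      simp only [map_pow, map_sub, Polynomial.aeval_X]
      rw [← neg_sub, neg_pow, hk, mul_zero]
  have hfin : Module.Finite (ZMod n) (Algebra.adjoin (ZMod n) {a}) :=
    Module.Finite.iff_fg.2 hint.fg_adjoin_singleton
  have : Finite (Algebra.adjoin (ZMod n) {a}) := Module.finite_of_finite (ZMod n)
  let x : Algebra.adjoin (ZMod n) {a} := ⟨a, Algebra.self_mem_adjoin_singleton _ a⟩
  obtain ⟨i, j, hij, h⟩ := Finite.exists_ne_map_eq_of_infinite fun i : ℕ => x ^ i
  have h' : a ^ i = a ^ j := congrArg Subtype.val h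
  rcases lt_or_gt_of_ne hij with hlt | hlt
  · exact ⟨i, j, hlt, h'⟩
  · exact ⟨j, i, hlt, h'.symm⟩

theorem TwoSidedIdeal.exists_sub_pow_mem {I : TwoSidedIdeal R} {a p : R} (hp : IsPotentElement p)
    (h : a - p ∈ I) : ∃ m : ℕ, 2 ≤ m ∧ a - a ^ m ∈ I := by
  obtain ⟨m, hm, hpm⟩ := hp
  refine ⟨m, hm, (I.rel_iff _ _).1 ?_⟩
  have hap : I.ringCon a p := (I.rel_iff _ _).2 h
  have hpow := I.ringCon.pow m hap
  rw [← hpm] at hpow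
  exact I.ringCon.trans hap (I.ringCon.symm hpow)

theorem exists_natCast_eq_zero_of_isNilpotent_two_sub_pow {m : ℕ} (hm : 2 ≤ m)
    (h : IsNilpotent ((2 : R) - 2 ^ m)) : ∃ N : ℕ, N ≠ 0 ∧ (N : R) = 0 := by
  obtain ⟨k, hk⟩ := h
  have hlt : 2 < 2 ^ m := by
    calc 2 < 2 ^ 2 := by norm_num
      _ ≤ 2 ^ m := Nat.pow_le_pow_right (by norm_num) hm
  refine ⟨(2 ^ m - 2) ^ k, pow_ne_zero _ (by omega), ?_⟩
  rw [Nat.cast_pow, Nat.cast_sub hlt.le, ← neg_sub, neg_pow]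
  push_cast
  rw [hk, mul_zero]

end

theorem corollary3p4 (R : Type*) [Ring R] :
    IsStronglyPeriodicRing R ↔
      IsWeaklyPeriodicRing R ∧
        ∀ P : TwoSidedIdeal R, P.IsPrimeIdeal → P.IsCompletelyPrimeIdeal := by
  constructor
  · intro h
    refine ⟨fun a => ?_, fun P hP => hP.isCompletelyPrimeIdeal_of_forall_potent fun a => ?_⟩
    · obtain ⟨p, hp, hap, -⟩ := h a
      exact ⟨p, hp, isNilpotent_of_mem_ringPrimeRadical hap⟩
    · obtain ⟨p, hp, hap, -⟩ := h a
      exact ⟨p, hp, (TwoSidedIdeal.mem_sInf R).1 hap P hP⟩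
  · rintro ⟨hw, hcp⟩
    have hrad : ∀ x : R, IsNilpotent x → x ∈ ringPrimeRadical R := fun x hx =>
      (TwoSidedIdeal.mem_sInf R).2 fun P hP => (hcp P hP).mem_of_isNilpotent hx
    have hpow : ∀ a : R, ∃ m : ℕ, 2 ≤ m ∧ IsNilpotent (a - a ^ m) := by
      intro a
      obtain ⟨p, hp, hap⟩ := hw a
      obtain ⟨m, hm, ham⟩ := TwoSidedIdeal.exists_sub_pow_mem hp (hrad _ hap)
      exact ⟨m, hm, isNilpotent_of_mem_ringPrimeRadical ham⟩
    intro a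
    obtain ⟨l, hl, h2⟩ := hpow 2
    obtain ⟨N, hN, hNR⟩ := exists_natCast_eq_zero_of_isNilpotent_two_sub_pow hl h2
    obtain ⟨m, hm, ham⟩ := hpow a
    obtain ⟨i, j, hij, h⟩ := exists_pow_eq_pow_of_isNilpotent_sub_pow hN hNR hm ham
    obtain ⟨n, hn, han⟩ := exists_isPotentElement_pow_of_pow_eq_pow hij h
    exact ⟨a ^ n, hn, hrad _ han, (Commute.self_pow a n).eq⟩
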